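/- Let $p$ be a prime, let $G$ be a finite $p$-separable group (that is, $G$ has a normal series each of whose factors is a $p$-group or a group of order not divisible by $p$), and let $H$ be a $p$-complement of $G$ (a subgroup of order not divisible by $p$ and of $p$-power index). Let $\Gamma_p(G)$ be the graph whose vertices are the non-central conjugacy classes of $G$ consisting of elements of order not divisible by $p$, two different classes being adjacent if and only if their cardinalities are not coprime. Suppose that $\Gamma_p(G)$ has exactly two vertices and one edge. Then one of the following holds: (a) $H$ is a $q$-group for some prime $q\neq p$; (b) there are two different primes $q$ and $r$, both distinct from $p$, such that $H$ is a Frobenius group whose kernel is an elementary abelian $q$-group and whose complements have order $r$. -/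

import Mathlib

/-- `G` is `p`-separable: it has a finite normal series, from the trivial subgroup to the whole
group, each of whose factors is a `p`-group (order a power of `p`) or a `p'`-group (order not
divisible by `p`).  The order of the factor `N (i + 1) / N i` is the relative index.
(Used for finite groups only.) -/
def IsPSeparable (p : ℕ) (G : Type*) [Group G] : Prop :=
  ∃ (n : ℕ) (N : ℕ → Subgroup G), N 0 = ⊥ ∧ N n = ⊤ ∧ (∀ i, (N i).Normal) ∧
    ∀ i < n, N i ≤ N (i + 1) ∧
      ((∃ k : ℕ, (N i).relIndex (N (i + 1)) = p ^ k) ∨ ¬ p ∣ (N i).relIndex (N (i + 1)))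

/-- `H` is a `p`-complement of the finite group `G`, that is, a Hall `p'`-subgroup:
its order is not divisible by `p` and its index is a power of `p`. -/
def IsPComplement {G : Type*} [Group G] (p : ℕ) (H : Subgroup G) : Prop :=
  ¬ p ∣ Nat.card H ∧ ∃ k : ℕ, H.index = p ^ k

/-- The conjugacy classes of `G` that are non-central and consist of `p`-regular elements
(elements whose order is not divisible by `p`). -/
def PRegularNoncentralClass (p : ℕ) (G : Type*) [Group G] : Type _ :=
  {c : ConjClasses G // c ∈ ConjClasses.noncenter G ∧ ∀ g ∈ c.carrier, ¬ p ∣ orderOf g}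

/-- The common divisor graph `Γ_p(G)`: the vertices are the non-central conjugacy classes of
`p`-regular elements, and two different classes are adjacent iff their cardinalities are not
coprime. -/
def commonDivisorGraph (p : ℕ) (G : Type*) [Group G] :
    SimpleGraph (PRegularNoncentralClass p G) where
  Adj c d := c ≠ d ∧ ¬ Nat.Coprime (Nat.card c.1.carrier) (Nat.card d.1.carrier)
  symm := ⟨fun _ _ h => ⟨h.1.symm, fun hc => h.2 hc.symm⟩⟩
  loopless := ⟨fun _ h => h.1 rfl⟩

/-- The group `H` is a Frobenius group with kernel `K` and complement `C`: `K` is a non-trivial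
normal subgroup, `C` is a non-trivial complement of `K` (`K ⊓ C = ⊥` and `K C = H`), and no
non-trivial element of `C` commutes with a non-trivial element of `K`. -/
structure IsFrobeniusWith {H : Type*} [Group H] (K C : Subgroup H) : Prop where
  normal : K.Normal
  kernel_ne_bot : K ≠ ⊥
  complement_ne_bot : C ≠ ⊥
  isComplement : Subgroup.IsComplement' K C
  fixedPointFree : ∀ c ∈ C, c ≠ 1 → ∀ k ∈ K, k ≠ 1 → c * k * c⁻¹ ≠ k

/-- The group `H` is a Frobenius group. -/
def IsFrobeniusGroup (H : Type*) [Group H] : Prop :=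
  ∃ K C : Subgroup H, IsFrobeniusWith K C

/-- The subgroup `K` is an elementary abelian `q`-group (for a prime `q`): it is abelian and all
its elements `k` satisfy `k ^ q = 1`. -/
def IsElementaryAbelian {H : Type*} [Group H] (q : ℕ) (K : Subgroup H) : Prop :=
  (∀ x ∈ K, ∀ y ∈ K, x * y = y * x) ∧ ∀ x ∈ K, x ^ q = 1

/-! Suppose that $H$ is not a $q$-group. A central $p$-regular element of prime order could be
multiplied onto a noncentral element of coprime prime-power order, and this conflicts with having
only two classes (`false_of_central_of_card_eq_two`). So the nontrivial $p$-regular elements form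
exactly two classes, of prime orders $q$ and $r$ (`exists_hasTwoPrimeOrderClasses`). By
$p$-separability some quotient of $G$ by a normal $p$-subgroup has a nontrivial normal $p'$-subgroup
$M$. If both primes occur in $M$, conjugacy in $G$ puts every element of order $q$ or $r$ in the
centre of a Sylow subgroup of $M$; counting these centres forces Burnside's transfer condition at
one prime. Hence the elements of order $q$, say, commute modulo a $p$-group, and so commute in $H$.
They then form an abelian normal Sylow subgroup of $H$, and a complement acts on it without fixed
points. Such a complement has exponent $r$, and a norm computation
(`pow_eq_one_of_prod_pow_apply_eq_one`) gives it order $r$. -/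

/-! ### Norms of fixed-point-free automorphisms. -/

/-- Applying `g` only permutes the factors cyclically, so the product is a fixed point. -/
theorem MulAut.prod_pow_apply_eq_one {K : Type*} [CommGroup K] {r : ℕ} (g : MulAut K)
    (hg : g ^ r = 1) (hfix : ∀ k, g k = k → k = 1) (k : K) :
    ∏ i ∈ Finset.range r, (g ^ i) k = 1 := by
  apply hfix
  have h1 := Finset.prod_range_succ (fun i => (g ^ i) k) r
  have h2 := Finset.prod_range_succ' (fun i => (g ^ i) k) r
  rw [h1, hg, pow_zero] at h2
  rw [map_prod]
  have h3 := mul_right_cancel h2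
  rw [h3]
  refine Finset.prod_congr rfl fun i _ => ?_
  rw [pow_succ', MulAut.mul_apply]

/-- Evaluate $\prod_{i,j} (ef^j)^i k$ in both orders. Each product over $i$ is trivial. The product
over $j$ is $e^i$ of a norm of $f^i$, which is trivial unless $i = 0$, where it is $k^r$. -/
theorem pow_eq_one_of_prod_pow_apply_eq_one {K : Type*} [CommGroup K] {r : ℕ} (hr : 0 < r)
    {e f : MulAut K} (hef : Commute e f)
    (hf : ∀ i, 0 < i → i < r → ∀ k, ∏ j ∈ Finset.range r, ((f ^ i) ^ j) k = 1)
    (he : ∀ j k, ∏ i ∈ Finset.range r, ((e * f ^ j) ^ i) k = 1) (k : K) : k ^ r = 1 := by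
  have h1 : ∏ j ∈ Finset.range r, ∏ i ∈ Finset.range r, ((e * f ^ j) ^ i) k = 1 :=
    Finset.prod_eq_one fun j _ => he j k
  rw [Finset.prod_comm] at h1
  have h2 : ∀ i, ∏ j ∈ Finset.range r, ((e * f ^ j) ^ i) k =
      (e ^ i) (∏ j ∈ Finset.range r, ((f ^ i) ^ j) k) := by
    intro i
    rw [map_prod]
    refine Finset.prod_congr rfl fun j _ => ?_
    rw [(hef.pow_right j).mul_pow, MulAut.mul_apply, ← pow_mul, ← pow_mul, mul_comm]
  simp_rw [h2] at h1
  rw [Finset.prod_eq_single_of_mem 0 (Finset.mem_range.2 hr)] at h1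
  · simpa using h1
  · intro i hi h0
    rw [hf i (Nat.pos_of_ne_zero h0) (Finset.mem_range.1 hi), map_one]

/-! ### Groups whose nontrivial elements have order $q$ or $r$. -/

/-- All nontrivial elements of `H` have order `q` or `r`, and both orders occur. -/
structure HasOrdersOneOrTwoPrimes (q r : ℕ) (H : Type*) [Group H] : Prop where
  prime_left : q.Prime
  prime_right : r.Prime
  ne : q ≠ r
  orderOf_eq : ∀ h : H, h ≠ 1 → orderOf h = q ∨ orderOf h = r
  exists_left : ∃ h : H, orderOf h = q
  exists_right : ∃ h : H, orderOf h = r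

theorem isPGroup_of_forall_orderOf_eq {H : Type*} [Group H] {r : ℕ}
    (h : ∀ x : H, x ≠ 1 → orderOf x = r) : IsPGroup r H := by
  intro x
  by_cases hx : x = 1
  · exact ⟨0, by simp [hx]⟩
  · exact ⟨1, by rw [pow_one, ← h x hx, pow_orderOf_eq_one]⟩

theorem ne_one_of_orderOf_eq_prime {H : Type*} [Monoid H] {q : ℕ} (hq : q.Prime) {x : H}
    (hx : orderOf x = q) : x ≠ 1 := by
  rintro rfl
  rw [orderOf_one] at hx
  exact hq.one_lt.ne hx

namespace HasOrdersOneOrTwoPrimes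

variable {q r : ℕ} {H : Type*} [Group H]

theorem not_commute (h : HasOrdersOneOrTwoPrimes q r H) {x y : H} (hx : orderOf x = q)
    (hy : orderOf y = r) : ¬ Commute x y := by
  intro hc
  have hcop : (orderOf x).Coprime (orderOf y) := by
    rw [hx, hy]; exact (Nat.coprime_primes h.prime_left h.prime_right).2 h.ne
  have h1 := hc.orderOf_mul_eq_mul_orderOf_of_coprime hcop
  rw [hx, hy] at h1
  have hq := h.prime_left.one_lt
  have hr := h.prime_right.one_lt
  have hne : x * y ≠ 1 := by
    intro h0
    rw [h0, orderOf_one] at h1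
    nlinarith
  rcases h.orderOf_eq _ hne with h2 | h2 <;> rw [h2] at h1 <;> nlinarith

/-- The subgroup of elements of order dividing `q`, when they commute. -/
def kernel (q : ℕ) (H : Type*) [Group H]
    (hc : ∀ x y : H, x ^ q = 1 → y ^ q = 1 → Commute x y) : Subgroup H where
  carrier := {x | x ^ q = 1}
  one_mem' := one_pow q
  mul_mem' {x y} hx hy := by
    show (x * y) ^ q = 1
    rw [(hc x y hx hy).mul_pow, show x ^ q = 1 from hx, show y ^ q = 1 from hy, one_mul]
  inv_mem' {x} hx := by
    show x⁻¹ ^ q = 1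
    rw [inv_pow, show x ^ q = 1 from hx, inv_one]

theorem mem_kernel {hc : ∀ x y : H, x ^ q = 1 → y ^ q = 1 → Commute x y} {x : H} :
    x ∈ kernel q H hc ↔ x ^ q = 1 := Iff.rfl

instance kernel_normal (hc : ∀ x y : H, x ^ q = 1 → y ^ q = 1 → Commute x y) :
    (kernel q H hc).Normal := by
  constructor
  intro x hx g
  rw [mem_kernel] at *
  rw [conj_pow, hx, mul_one, mul_inv_cancel]

/-- A complement of the elements of order dividing `q` has order `r`. -/
theorem card_complement [Finite H] (h : HasOrdersOneOrTwoPrimes q r H)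
    (hc : ∀ x y : H, x ^ q = 1 → y ^ q = 1 → Commute x y) {R : Subgroup H}
    (hR : (kernel q H hc).IsComplement' R) : Nat.card R = r := by
  have : Fact r.Prime := ⟨h.prime_right⟩
  have hord : ∀ x ∈ R, x ≠ 1 → orderOf x = r := by
    intro x hx h1
    refine (h.orderOf_eq x h1).resolve_left fun h2 => h1 ?_
    have : x ∈ kernel q H hc ⊓ R := ⟨mem_kernel.2 (by rw [← h2, pow_orderOf_eq_one]), hx⟩
    rwa [hR.disjoint.eq_bot, Subgroup.mem_bot] at this
  have hpR : IsPGroup r R := isPGroup_of_forall_orderOf_eq fun x hx => by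
    rw [← Subgroup.orderOf_coe]
    exact hord x x.2 (by simpa using hx)
  have hdvd : r ∣ Nat.card R := by
    have h1 : r ∣ Nat.card H := by
      obtain ⟨y, hy⟩ := h.exists_right
      rw [← hy]; exact orderOf_dvd_natCard y
    rw [← hR.card_mul_card] at h1
    refine (h.prime_right.dvd_mul.1 h1).resolve_left fun h2 => ?_
    obtain ⟨y, hy⟩ := exists_prime_orderOf_dvd_card' r h2
    have h3 : orderOf (y : H) ∣ q := orderOf_dvd_of_pow_eq_one y.2
    rw [Subgroup.orderOf_coe, hy] at h3
    exact h.ne ((Nat.prime_dvd_prime_iff_eq h.prime_right h.prime_left).1 h3).symm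
  have hnt : Nontrivial R := by
    rw [← Finite.one_lt_card_iff_nontrivial]
    exact h.prime_right.one_lt.trans_le (Nat.le_of_dvd Nat.card_pos hdvd)
  -- If $|R| \ne r$, take $f$ central of order $r$ in $R$ and $e$ outside $\langle f\rangle$: all
  -- $ef^j$ and all $f^i$ with $0<i<r$ are nontrivial, so the norm computation applies and kills an
  -- element of order $q$.
  by_contra hne
  have := hpR.center_nontrivial
  obtain ⟨f, hf1⟩ := exists_ne (1 : Subgroup.center R)
  have hfR : ((f : R) : H) ≠ 1 := by simpa using hf1
  have hfr := hord _ (f : R).2 hfR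
  obtain ⟨e, he⟩ : ∃ e : R, e ∉ Subgroup.zpowers (f : R) := by
    by_contra! hall
    have : Subgroup.zpowers (f : R) = ⊤ := by
      rw [eq_top_iff]; exact fun x _ => hall x
    have h2 := Nat.card_zpowers (f : R)
    rw [this, Subgroup.card_top, ← Subgroup.orderOf_coe, hfr] at h2
    exact hne h2
  let _ : CommGroup (kernel q H hc) :=
    { (inferInstance : Group (kernel q H hc)) with
      mul_comm := fun a b => Subtype.ext (hc a b a.2 b.2) }
  let φ : R →* MulAut (kernel q H hc) := (MulAut.conjNormal (H := kernel q H hc)).comp R.subtype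
  have hnorm : ∀ g : R, g ≠ 1 → ∀ k, ∏ i ∈ Finset.range r, ((φ g) ^ i) k = 1 := by
    intro g hg
    have hg' : (g : H) ≠ 1 := by simpa using hg
    have hgr := hord g g.2 hg'
    refine MulAut.prod_pow_apply_eq_one _ ?_ ?_
    · rw [← map_pow, ← hgr, Subgroup.orderOf_coe, pow_orderOf_eq_one, map_one]
    · intro k hk
      by_contra hk1
      have hkq : orderOf (k : H) = q := by
        have := Fact.mk h.prime_left
        exact orderOf_eq_prime k.2 (by simpa using hk1)
      refine h.not_commute hkq hgr ?_
      have h3 := congrArg Subtype.val hk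
      have h4 : (g : H) * k * (g : H)⁻¹ = k := h3
      rw [mul_inv_eq_iff_eq_mul] at h4
      exact h4.symm
  obtain ⟨k, hk⟩ := h.exists_left
  have hkq : k ^ q = 1 := by rw [← hk, pow_orderOf_eq_one]
  have hcomm : Commute (φ e) (φ f) := by
    refine Commute.map ?_ φ
    exact Subgroup.mem_center_iff.1 f.2 e
  have key := pow_eq_one_of_prod_pow_apply_eq_one h.prime_right.pos hcomm
    (fun i hi hir k => by
      rw [← map_pow]
      refine hnorm _ ?_ k
      intro h0
      have := orderOf_dvd_of_pow_eq_one h0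
      rw [← Subgroup.orderOf_coe, hfr] at this
      exact absurd (Nat.le_of_dvd hi this) (by omega))
    (fun j k => by
      rw [← map_pow, ← map_mul]
      refine hnorm _ ?_ k
      intro h0
      refine he ?_
      rw [mul_eq_one_iff_eq_inv.1 h0]
      exact inv_mem (Subgroup.npow_mem_zpowers _ _)) ⟨k, hkq⟩
  have h5 : k ^ r = 1 := congrArg Subtype.val key
  have h6 := orderOf_dvd_of_pow_eq_one h5
  rw [hk] at h6
  exact h.ne ((Nat.prime_dvd_prime_iff_eq h.prime_left h.prime_right).1 h6)

theorem isPGroup_kernel (hc : ∀ x y : H, x ^ q = 1 → y ^ q = 1 → Commute x y) :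
    IsPGroup q (kernel q H hc) :=
  fun x => ⟨1, Subtype.ext (by rw [pow_one]; exact x.2)⟩

/-- The kernel is a full Sylow $q$-subgroup, so Schur–Zassenhaus applies. -/
theorem exists_complement [Finite H] (h : HasOrdersOneOrTwoPrimes q r H)
    (hc : ∀ x y : H, x ^ q = 1 → y ^ q = 1 → Commute x y) :
    ∃ R : Subgroup H, (kernel q H hc).IsComplement' R := by
  have : Fact q.Prime := ⟨h.prime_left⟩
  refine Subgroup.exists_right_complement'_of_coprime ?_
  obtain ⟨P, hP⟩ := (isPGroup_kernel hc).exists_le_sylow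
  have hPK : (P : Subgroup H) = kernel q H hc := by
    refine le_antisymm (fun x hx => ?_) hP
    by_cases hx1 : x = 1
    · rw [hx1]; exact one_mem _
    rcases h.orderOf_eq x hx1 with h1 | h1
    · rw [mem_kernel, ← h1, pow_orderOf_eq_one]
    · obtain ⟨k, hk⟩ := IsPGroup.iff_orderOf.1 P.isPGroup' ⟨x, hx⟩
      rw [← Subgroup.orderOf_coe, h1] at hk
      have := h.prime_right.dvd_of_dvd_pow hk.dvd
      exact absurd ((Nat.prime_dvd_prime_iff_eq h.prime_right h.prime_left).1 this).symm h.ne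
  rw [← hPK]
  exact P.card_coprime_index

theorem isFrobeniusGroup [Finite H] (h : HasOrdersOneOrTwoPrimes q r H)
    (hc : ∀ x y : H, x ^ q = 1 → y ^ q = 1 → Commute x y) : IsFrobeniusGroup H := by
  have hqF : Fact q.Prime := ⟨h.prime_left⟩
  obtain ⟨R, hR⟩ := h.exists_complement hc
  have hcard := h.card_complement hc hR
  refine ⟨kernel q H hc, R, kernel_normal hc, ?_, ?_, hR, ?_⟩
  · intro hbot
    obtain ⟨k, hk⟩ := h.exists_left
    have : k ∈ kernel q H hc := by rw [mem_kernel, ← hk, pow_orderOf_eq_one]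
    rw [hbot, Subgroup.mem_bot] at this
    exact ne_one_of_orderOf_eq_prime h.prime_left hk this
  · rintro rfl
    rw [Subgroup.card_bot] at hcard
    exact h.prime_right.one_lt.ne hcard
  · intro c hcR hc1 k hk hk1 hck
    have hcr : orderOf c = r := by
      refine orderOf_eq_prime_iff (p := r) (hp := ⟨h.prime_right⟩) |>.2 ⟨?_, hc1⟩
      rw [← orderOf_dvd_iff_pow_eq_one, ← hcard, ← Subgroup.orderOf_mk c hcR]
      exact orderOf_dvd_natCard _
    refine h.not_commute (orderOf_eq_prime hk hk1) hcr ?_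
    rw [mul_inv_eq_iff_eq_mul] at hck
    exact hck.symm

/-- The Frobenius pair is arbitrary here, so it must be compared with the known decomposition of
$H$; the key fact is that $r$ divides $|H|$ exactly once. -/
theorem of_isFrobeniusWith [Finite H] (h : HasOrdersOneOrTwoPrimes q r H)
    (hc : ∀ x y : H, x ^ q = 1 → y ^ q = 1 → Commute x y) {K C : Subgroup H}
    (hKC : IsFrobeniusWith K C) : IsElementaryAbelian q K ∧ Nat.card C = r := by
  have hrF : Fact r.Prime := ⟨h.prime_right⟩
  obtain ⟨R, hR⟩ := h.exists_complement hc
  have hRcard := h.card_complement hc hR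
  have hN := hKC.normal
  have hnc : ∀ c ∈ C, c ≠ 1 → ∀ k ∈ K, k ≠ 1 → ¬ Commute c k := by
    intro c hcC hc1 k hk hk1 hck
    refine hKC.fixedPointFree c hcC hc1 k hk hk1 ?_
    rw [hck.eq, mul_inv_cancel_right]
  have hHcard : Nat.card H = Nat.card (kernel q H hc) * r := by
    rw [← hRcard, hR.card_mul_card]
  have hqpow : ∀ x : H, orderOf x = q → x ^ q = 1 := fun x hx => by
    rw [← hx, pow_orderOf_eq_one]
  have hcop : (Nat.card (kernel q H hc)).Coprime r := by
    have := Fact.mk h.prime_left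
    obtain ⟨n, hn⟩ := IsPGroup.iff_card.1 (isPGroup_kernel hc)
    rw [hn]
    exact ((Nat.coprime_primes h.prime_left h.prime_right).2 h.ne).pow_left n
  have hKle : ∀ y ∈ K, y ^ q = 1 := by
    intro y hyK
    by_cases hy1 : y = 1
    · rw [hy1, one_pow]
    refine (h.orderOf_eq y hy1).elim (hqpow y) fun hyr => ?_
    exfalso
    have hrK : r ∣ Nat.card K := by
      rw [← hyr, ← Subgroup.orderOf_mk y hyK]; exact orderOf_dvd_natCard _
    -- As $K$ uses up the only factor $r$ of $|H|$, a nontrivial $c \in C$ has order $q$.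
    obtain ⟨c, hcC, hc1⟩ := C.bot_or_exists_ne_one.resolve_left hKC.complement_ne_bot
    have hcq : orderOf c = q := by
      refine (h.orderOf_eq _ hc1).resolve_right fun hcr => ?_
      have hrC : r ∣ Nat.card C := by
        rw [← hcr, ← Subgroup.orderOf_mk c hcC]; exact orderOf_dvd_natCard _
      have h2 := mul_dvd_mul hrK hrC
      rw [hKC.isComplement.card_mul_card, hHcard] at h2
      have h3 := Nat.dvd_of_mul_dvd_mul_right h.prime_right.pos h2
      exact h.prime_right.one_lt.ne' (Nat.eq_one_of_dvd_coprimes hcop.symm dvd_rfl h3)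
    obtain ⟨k, hk⟩ := h.exists_left
    refine h.not_commute hk hyr ?_
    -- The commutator lies in $K$ and in the abelian kernel containing $c$, so it commutes with $c$
    -- and must be trivial.
    have hmem : k * y * k⁻¹ * y⁻¹ ∈ K := mul_mem (hN.conj_mem y hyK k) (inv_mem hyK)
    have hmem' : k * y * k⁻¹ * y⁻¹ ∈ kernel q H hc := by
      have := mul_mem (hqpow k hk : k ∈ kernel q H hc)
        ((kernel_normal hc).conj_mem k⁻¹ (inv_mem (hqpow k hk : k ∈ kernel q H hc)) y)
      simpa only [mul_assoc] using this
    have h1 : k * y * k⁻¹ * y⁻¹ = 1 := by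
      by_contra hne
      exact hnc c hcC hc1 _ hmem hne (hc _ _ (hqpow _ hcq) hmem')
    rw [mul_inv_eq_one, mul_inv_eq_iff_eq_mul] at h1
    exact h1
  refine ⟨⟨fun x hx y hy => hc x y (hKle x hx) (hKle y hy), hKle⟩, ?_⟩
  obtain ⟨k, hk, hk1⟩ := K.bot_or_exists_ne_one.resolve_left hKC.kernel_ne_bot
  have hCr : IsPGroup r C := isPGroup_of_forall_orderOf_eq fun x hx => by
    rw [← Subgroup.orderOf_coe]
    have hx1 : (x : H) ≠ 1 := by simpa using hx
    refine (h.orderOf_eq _ hx1).resolve_left fun hxq => ?_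
    exact hnc x x.2 hx1 k hk hk1 (hc _ _ (hqpow _ hxq) (hKle _ hk))
  obtain ⟨n, hn⟩ := IsPGroup.iff_card.1 hCr
  have hn0 : n ≠ 0 := by
    rintro rfl
    exact hKC.complement_ne_bot (Subgroup.eq_bot_of_card_eq C (by simpa using hn))
  have hdvd : r ^ n ∣ r := by
    have h1 : Nat.card C ∣ Nat.card H := Subgroup.card_subgroup_dvd_card C
    rw [hn, hHcard] at h1
    exact (hcop.symm.pow_left n).dvd_of_dvd_mul_left h1
  rw [hn]
  exact Nat.dvd_antisymm hdvd (dvd_pow_self r hn0)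

end HasOrdersOneOrTwoPrimes

/-! ### Reduction to two classes of elements of prime order. -/

theorem IsConj.orderOf_eq_orderOf {G : Type*} [Group G] {a b : G} (h : IsConj a b) :
    orderOf a = orderOf b := by
  obtain ⟨c, rfl⟩ := isConj_iff.1 h
  exact (MulEquiv.orderOf_eq (MulAut.conj c) a).symm

theorem ConjClasses.mk_mem_noncenter {G : Type*} [Group G] {g : G} (hg : g ∉ Subgroup.center G) :
    ConjClasses.mk g ∈ ConjClasses.noncenter G := by
  rw [ConjClasses.mem_noncenter]
  rw [Subgroup.mem_center_iff] at hg
  push Not at hg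
  obtain ⟨x, hx⟩ := hg
  refine ⟨g, ConjClasses.mem_carrier_mk, x * g * x⁻¹, ?_, ?_⟩
  · rw [ConjClasses.mem_carrier_iff_mk_eq, ConjClasses.mk_eq_mk_iff_isConj]
    exact (isConj_iff.2 ⟨x, rfl⟩).symm
  · intro h
    exact hx ((mul_inv_eq_iff_eq_mul.1 h.symm))

/-- The noncentral class of a noncentral `p`-regular element. -/
def PRegularNoncentralClass.mk {p : ℕ} {G : Type*} [Group G] (g : G) (hp : ¬ p ∣ orderOf g)
    (hg : g ∉ Subgroup.center G) : PRegularNoncentralClass p G :=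
  ⟨ConjClasses.mk g, ConjClasses.mk_mem_noncenter hg, fun h hh => by
    rw [ConjClasses.mem_carrier_iff_mk_eq, ConjClasses.mk_eq_mk_iff_isConj] at hh
    rwa [hh.orderOf_eq_orderOf]⟩

theorem PRegularNoncentralClass.exists_rep {p : ℕ} {G : Type*} [Group G]
    (c : PRegularNoncentralClass p G) :
    ∃ g : G, ¬ p ∣ orderOf g ∧ g ∉ Subgroup.center G := by
  obtain ⟨c, hc, hp⟩ := c
  rw [ConjClasses.mem_noncenter] at hc
  obtain ⟨g, hg, h, hh, hne⟩ := hc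
  refine ⟨g, hp g hg, fun hz => hne ?_⟩
  rw [ConjClasses.mem_carrier_iff_mk_eq] at hg hh
  rw [← hh, ConjClasses.mk_eq_mk_iff_isConj] at hg
  obtain ⟨x, hx⟩ := isConj_iff.1 hg
  rw [← hx, Subgroup.mem_center_iff.1 hz x, mul_inv_cancel_right]

section TwoClasses

variable {p : ℕ} {G : Type*} [Group G]

theorem isConj_or_isConj_of_card_eq_two (hV : Nat.card (PRegularNoncentralClass p G) = 2)
    {x y g : G} (hx : ¬ p ∣ orderOf x) (hx' : x ∉ Subgroup.center G) (hy : ¬ p ∣ orderOf y)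
    (hy' : y ∉ Subgroup.center G) (hxy : orderOf x ≠ orderOf y) (hg : ¬ p ∣ orderOf g)
    (hg' : g ∉ Subgroup.center G) : IsConj g x ∨ IsConj g y := by
  have h1 := (Nat.card_eq_two_iff' (PRegularNoncentralClass.mk x hx hx')).1 hV
  by_contra! h2
  have hmk : ∀ {a b : G} (ha : ¬ p ∣ orderOf a) (ha' : a ∉ Subgroup.center G)
      (hb : ¬ p ∣ orderOf b) (hb' : b ∉ Subgroup.center G),
      PRegularNoncentralClass.mk a ha ha' = PRegularNoncentralClass.mk b hb hb' → IsConj a b :=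
    fun ha ha' hb hb' h => ConjClasses.mk_eq_mk_iff_isConj.1 (congrArg Subtype.val h)
  have h3 := h1.unique (y₁ := PRegularNoncentralClass.mk g hg hg')
    (y₂ := PRegularNoncentralClass.mk y hy hy') (fun h => h2.1 (hmk _ _ _ _ h))
    (fun h => hxy (hmk _ _ _ _ h).orderOf_eq_orderOf.symm)
  exact h2.2 (hmk _ _ _ _ h3)

/-- Raising to the power `orderOf x` removes $x$ from the conjugacy and is injective on the central
parts by coprimality. -/
theorem eq_of_isConj_mul_of_mem_center {x z w : G} (hz : z ∈ Subgroup.center G)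
    (hw : w ∈ Subgroup.center G) (h : IsConj (x * z) (x * w))
    (hc : (orderOf x).Coprime (orderOf z)) (hc' : (orderOf x).Coprime (orderOf w)) : z = w := by
  obtain ⟨g, hg⟩ := isConj_iff.1 h
  have hzc : Commute x z := Subgroup.mem_center_iff.1 hz x
  have hwc : Commute x w := Subgroup.mem_center_iff.1 hw x
  have hzw : Commute z w := Subgroup.mem_center_iff.1 hw z
  have h1 : z ^ orderOf x = w ^ orderOf x := by
    have h2 := congrArg (· ^ orderOf x) hg
    simp only [conj_pow, hzc.mul_pow, hwc.mul_pow, pow_orderOf_eq_one, one_mul] at h2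
    rwa [Subgroup.mem_center_iff.1 (pow_mem hz _) g, mul_inv_cancel_right] at h2
  have h3 : (z * w⁻¹) ^ orderOf x = 1 := by
    rw [hzw.inv_right.mul_pow, inv_pow, h1, mul_inv_cancel]
  have h4 := orderOf_dvd_of_pow_eq_one h3
  have h5 : orderOf (z * w⁻¹) ∣ orderOf z * orderOf w := by
    have := hzw.inv_right.orderOf_mul_dvd_mul_orderOf
    rwa [orderOf_inv] at this
  have h6 := Nat.eq_one_of_dvd_coprimes (hc.mul_right hc') h4 h5
  exact mul_inv_eq_one.1 (orderOf_eq_one_iff.1 h6)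

/-- There is no central element of prime order `s ≠ p` once there is a noncentral `q`-element with
`q ≠ p, s`. -/
theorem false_of_central_of_card_eq_two [Finite G] (hp : p.Prime)
    (hV : Nat.card (PRegularNoncentralClass p G) = 2) {q s k : ℕ} (hq : q.Prime) (hs : s.Prime)
    (hqp : q ≠ p) (hsp : s ≠ p) (hqs : q ≠ s) {x z : G} (hx : orderOf x = q ^ k)
    (hxZ : x ∉ Subgroup.center G) (hz : orderOf z = s) (hzZ : z ∈ Subgroup.center G) : False := by
  have hk : k ≠ 0 := by
    rintro rfl
    rw [pow_zero, orderOf_eq_one_iff] at hx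
    exact hxZ (hx ▸ one_mem _)
  have hcop : (q ^ k).Coprime s := ((Nat.coprime_primes hq hs).2 hqs).pow_left k
  have hzx : ∀ w ∈ Subgroup.center G, Commute x w := fun w hw => Subgroup.mem_center_iff.1 hw x
  have hmulZ : ∀ w ∈ Subgroup.center G, x * w ∉ Subgroup.center G := fun w hw h =>
    hxZ (((Subgroup.center G).mul_mem_cancel_right hw).1 h)
  have hordm : ∀ w ∈ Subgroup.center G, orderOf w = s → orderOf (x * w) = q ^ k * s :=
    fun w hw hws => by
      rw [(hzx w hw).orderOf_mul_eq_mul_orderOf_of_coprime (by rwa [hx, hws]), hx, hws]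
  have hpx : ¬ p ∣ q ^ k := fun h => hqp ((Nat.prime_dvd_prime_iff_eq hp hq).1
    (hp.dvd_of_dvd_pow h)).symm
  have hpm : ¬ p ∣ q ^ k * s := fun h => (hp.dvd_mul.1 h).elim hpx fun h =>
    hsp ((Nat.prime_dvd_prime_iff_eq hp hs).1 h).symm
  have hqk : 0 < q ^ k := pow_pos hq.pos k
  have hlt : q ^ k < q ^ k * s := by nlinarith [hs.one_lt]
  -- The elements $x$ and $xz$ have different orders, so they represent the two classes.
  have key : ∀ g : G, ¬ p ∣ orderOf g → g ∉ Subgroup.center G → IsConj g x ∨ IsConj g (x * z) :=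
    fun g hg hgZ => isConj_or_isConj_of_card_eq_two hV (by rwa [hx]) hxZ
      (by rwa [hordm z hzZ hz]) (hmulZ z hzZ) (by rw [hx, hordm z hzZ hz]; exact hlt.ne) hg hgZ
  by_cases hs2 : s = 2
  · subst hs2
    have hqodd : Odd (q ^ k) := (Nat.coprime_two_right).1 hcop
    -- Both noncentral classes have order divisible by the odd prime $q$, so all 2-elements are
    -- central.
    have h2Z : ∀ g : G, (∃ j, orderOf g = 2 ^ j) → g ∈ Subgroup.center G := by
      rintro g ⟨j, hj⟩
      by_contra hgZ
      have hpg : ¬ p ∣ orderOf g := by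
        rw [hj]
        exact fun h => hsp ((Nat.prime_dvd_prime_iff_eq hp hs).1 (hp.dvd_of_dvd_pow h)).symm
      have hqd : q ∣ orderOf g := by
        rcases key g hpg hgZ with h | h
        · rw [h.orderOf_eq_orderOf, hx]; exact dvd_pow_self q hk
        · rw [h.orderOf_eq_orderOf, hordm z hzZ hz]
          exact (dvd_pow_self q hk).mul_right 2
      rw [hj] at hqd
      exact hqs ((Nat.prime_dvd_prime_iff_eq hq hs).1 (hq.dvd_of_dvd_pow hqd))
    have hxinv : IsConj x⁻¹ x := by
      refine (key x⁻¹ (by rwa [orderOf_inv, hx]) (by rwa [inv_mem_iff])).resolve_right fun h => ?_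
      have := h.orderOf_eq_orderOf
      rw [orderOf_inv, hx, hordm z hzZ hz] at this
      exact hlt.ne this
    obtain ⟨g, hg⟩ := isConj_iff.1 hxinv.symm
    -- With $m$ the odd part of the order of $g$, the power $g^m$ still inverts $x$ but is a
    -- 2-element, hence central; thus $x^2 = 1$, although $x$ has odd order.
    obtain ⟨e, m, hm, hem⟩ := Nat.exists_eq_two_pow_mul_odd (orderOf_pos g).ne'
    have hiter : ∀ n, Odd n → g ^ n * x * (g ^ n)⁻¹ = x⁻¹ := by
      rintro n ⟨j, rfl⟩
      have h2 : Commute (g ^ 2) x := by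
        have : g * (g * x * g⁻¹) * g⁻¹ = x := by
          rw [hg, ← conj_inv, hg, inv_inv]
        rw [pow_two]
        refine mul_inv_eq_iff_eq_mul.1 ?_
        rw [mul_inv_rev]
        simpa only [mul_assoc] using this
      have h3 : Commute (g ^ (2 * j)) x := by rw [pow_mul]; exact h2.pow_left j
      have h4 : g ^ (2 * j) * x * (g ^ (2 * j))⁻¹ = x := by rw [h3.eq, mul_inv_cancel_right]
      calc g ^ (2 * j + 1) * x * (g ^ (2 * j + 1))⁻¹
          = g * (g ^ (2 * j) * x * (g ^ (2 * j))⁻¹) * g⁻¹ := by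
            rw [pow_succ']; group
        _ = x⁻¹ := by rw [h4, hg]
    have hgm : g ^ m ∈ Subgroup.center G := by
      refine h2Z _ ⟨e, ?_⟩
      rw [orderOf_pow_of_dvd hm.pos.ne' ⟨2 ^ e, by rw [hem, mul_comm]⟩, hem,
        Nat.mul_div_cancel _ hm.pos]
    have h5 := hiter m hm
    rw [← Subgroup.mem_center_iff.1 hgm x, mul_inv_cancel_right] at h5
    have h6 : x ^ 2 = 1 := by rw [pow_two]; nth_rewrite 1 [h5]; exact inv_mul_cancel x
    have h7 := orderOf_dvd_of_pow_eq_one h6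
    rw [hx] at h7
    have h8 := Nat.eq_one_of_dvd_coprimes hcop dvd_rfl h7
    rw [h8, orderOf_eq_one_iff] at hx
    exact hxZ (hx ▸ one_mem _)
  -- For odd $s$, both $xz^2$ and $xz$ lie in the class of order $q^k s$, which forces $z^2 = z$.
  · have hz2 : orderOf (z ^ 2) = s := by
      rw [← hz]
      refine Nat.Coprime.orderOf_pow ?_
      rw [hz]; exact (Nat.coprime_primes hs Nat.prime_two).2 hs2
    have hz2Z : z ^ 2 ∈ Subgroup.center G := pow_mem hzZ 2
    have h1 : IsConj (x * z ^ 2) (x * z) := by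
      refine (key (x * z ^ 2) (by rwa [hordm _ hz2Z hz2]) (hmulZ _ hz2Z)).resolve_left fun h => ?_
      have := h.orderOf_eq_orderOf
      rw [hx, hordm _ hz2Z hz2] at this
      exact hlt.ne' this
    have h2 := eq_of_isConj_mul_of_mem_center hz2Z hzZ h1
      (by rwa [hx, hz2]) (by rwa [hx, hz])
    have h3 : z = 1 := by rwa [pow_two, mul_eq_left] at h2
    exact ne_one_of_orderOf_eq_prime hs hz h3

/-- An element is the product of its $q$-part and its $q'$-part, so one of them is noncentral;
induct on the order. -/
theorem exists_noncentral_of_prime_pow_order [Finite G] {x : G} (hp : ¬ p ∣ orderOf x)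
    (hx : x ∉ Subgroup.center G) :
    ∃ (q k : ℕ) (y : G), q.Prime ∧ q ≠ p ∧ orderOf y = q ^ k ∧ y ∉ Subgroup.center G := by
  induction hn : orderOf x using Nat.strong_induction_on generalizing x with
  | _ n ih =>
  have hn1 : n ≠ 1 := by
    rintro rfl
    exact hx (orderOf_eq_one_iff.1 hn ▸ one_mem _)
  have hn0 : n ≠ 0 := hn ▸ (orderOf_pos x).ne'
  obtain ⟨q, hq, hqn⟩ := Nat.exists_prime_and_dvd hn1
  have hqp : q ≠ p := by rintro rfl; exact hp (hn ▸ hqn)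
  obtain ⟨k, m, hqm, hkm⟩ := Nat.exists_eq_pow_mul_and_not_dvd hn0 q hq.ne_one
  have hm0 : m ≠ 0 := by rintro rfl; exact hn0 (by simpa using hkm)
  have hqk0 : q ^ k ≠ 0 := pow_ne_zero k hq.ne_zero
  have hA : orderOf (x ^ m) = q ^ k := by
    rw [orderOf_pow_of_dvd hm0 ⟨q ^ k, by rw [hn, hkm, mul_comm]⟩, hn, hkm,
      Nat.mul_div_cancel _ (Nat.pos_of_ne_zero hm0)]
  have hB : orderOf (x ^ q ^ k) = m := by
    rw [orderOf_pow_of_dvd hqk0 ⟨m, by rw [hn, hkm]⟩, hn, hkm,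
      Nat.mul_div_cancel_left _ (Nat.pos_of_ne_zero hqk0)]
  by_cases hAZ : x ^ m ∈ Subgroup.center G
  · by_cases hBZ : x ^ q ^ k ∈ Subgroup.center G
    · exfalso
      refine hx ?_
      have hcop : IsCoprime ((q ^ k : ℕ) : ℤ) (m : ℤ) :=
        Nat.isCoprime_iff_coprime.2 (((Nat.Prime.coprime_iff_not_dvd hq).2 hqm).pow_left k)
      obtain ⟨a, b, hab⟩ := hcop
      have : x = (x ^ q ^ k) ^ a * (x ^ m) ^ b := by
        rw [← zpow_natCast, ← zpow_natCast, ← zpow_mul, ← zpow_mul, ← zpow_add, mul_comm _ a,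
          mul_comm _ b, hab, zpow_one]
      rw [this]
      exact mul_mem (zpow_mem hBZ a) (zpow_mem hAZ b)
    · refine ih m ?_ (x := x ^ q ^ k) ?_ hBZ hB
      · rw [hkm]
        have hk : k ≠ 0 := by
          rintro rfl
          rw [pow_zero, one_mul] at hkm
          exact hqm (hkm ▸ hqn)
        have : 1 < q ^ k := Nat.one_lt_pow hk hq.one_lt
        have := Nat.pos_of_ne_zero hm0
        nlinarith
      · rw [hB]; exact fun h => hp (hn ▸ hkm ▸ h.mul_left _)
  · exact ⟨q, k, x ^ m, hq, hqp, hA, hAZ⟩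

end TwoClasses

/-- The nontrivial `p`-regular elements of `G` form two conjugacy classes, of elements of order
`q` and `r`. -/
structure HasTwoPrimeOrderClasses (p q r : ℕ) (G : Type*) [Group G] : Prop where
  prime : p.Prime
  prime_left : q.Prime
  prime_right : r.Prime
  left_ne : q ≠ p
  right_ne : r ≠ p
  ne : q ≠ r
  orderOf_eq : ∀ g : G, g ≠ 1 → ¬ p ∣ orderOf g → orderOf g = q ∨ orderOf g = r
  exists_left : ∃ g : G, orderOf g = q
  exists_right : ∃ g : G, orderOf g = r
  isConj_left : ∀ g h : G, orderOf g = q → orderOf h = q → IsConj g h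
  isConj_right : ∀ g h : G, orderOf g = r → orderOf h = r → IsConj g h

theorem HasTwoPrimeOrderClasses.symm {p q r : ℕ} {G : Type*} [Group G]
    (h : HasTwoPrimeOrderClasses p q r G) : HasTwoPrimeOrderClasses p r q G :=
  ⟨h.prime, h.prime_right, h.prime_left, h.right_ne, h.left_ne, h.ne.symm,
    fun g h1 h2 => (h.orderOf_eq g h1 h2).symm, h.exists_right, h.exists_left, h.isConj_right,
    h.isConj_left⟩

theorem exists_hasTwoPrimeOrderClasses {p : ℕ} {G : Type*} [Group G] [Finite G] (hp : p.Prime)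
    (hV : Nat.card (PRegularNoncentralClass p G) = 2)
    (hN : ∀ q : ℕ, q.Prime → q ≠ p → ∃ s : ℕ, s.Prime ∧ s ≠ p ∧ s ≠ q ∧ s ∣ Nat.card G) :
    ∃ q r, HasTwoPrimeOrderClasses p q r G := by
  have hpd : ∀ {s k : ℕ}, s.Prime → s ≠ p → ¬ p ∣ s ^ k := fun hs hsp h =>
    hsp ((Nat.prime_dvd_prime_iff_eq hp hs).1 (hp.dvd_of_dvd_pow h)).symm
  have hne : Nonempty (PRegularNoncentralClass p G) :=
    (Nat.card_pos_iff.1 (by rw [hV]; exact two_pos)).1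
  obtain ⟨x₀, hx₀, hx₀Z⟩ := PRegularNoncentralClass.exists_rep hne.some
  obtain ⟨q, k, x, hq, hqp, hx, hxZ⟩ := exists_noncentral_of_prime_pow_order hx₀ hx₀Z
  obtain ⟨r, hr, hrp, hrq, hrG⟩ := hN q hq hqp
  have hk : k ≠ 0 := by
    rintro rfl
    rw [pow_zero, orderOf_eq_one_iff] at hx
    exact hxZ (hx ▸ one_mem _)
  have := Fact.mk hr
  obtain ⟨y, hy⟩ := exists_prime_orderOf_dvd_card' r hrG
  have hyZ : y ∉ Subgroup.center G := fun hyZ =>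
    false_of_central_of_card_eq_two hp hV hq hr hqp hrp hrq.symm hx hxZ hy hyZ
  have hZ : ∀ g : G, g ≠ 1 → ¬ p ∣ orderOf g → g ∉ Subgroup.center G := by
    intro g hg hpg hgZ
    obtain ⟨t, ht, htg⟩ := Nat.exists_prime_and_dvd (mt orderOf_eq_one_iff.1 hg)
    have htp : t ≠ p := by rintro rfl; exact hpg htg
    obtain ⟨m, hm⟩ := htg
    have hm0 : m ≠ 0 := by
      rintro rfl
      exact (orderOf_pos g).ne' (by simpa using hm)
    have hgt : orderOf (g ^ m) = t := by
      rw [orderOf_pow_of_dvd hm0 ⟨t, by rw [hm, mul_comm]⟩, hm,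
        Nat.mul_div_cancel _ (Nat.pos_of_ne_zero hm0)]
    by_cases htq : q = t
    · exact false_of_central_of_card_eq_two (k := 1) hp hV hr ht hrp htp (by rw [← htq]; exact hrq)
        (by rw [pow_one]; exact hy) hyZ hgt (pow_mem hgZ m)
    · exact false_of_central_of_card_eq_two hp hV hq ht hqp htp htq hx hxZ hgt (pow_mem hgZ m)
  have hxy : orderOf x ≠ orderOf y := by
    rw [hx, hy]
    intro h
    exact hrq ((Nat.prime_dvd_prime_iff_eq hq hr).1 (h ▸ dvd_pow_self q hk)).symm
  have key : ∀ g : G, g ≠ 1 → ¬ p ∣ orderOf g → IsConj g x ∨ IsConj g y := fun g hg hpg =>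
    isConj_or_isConj_of_card_eq_two hV (by rw [hx]; exact hpd hq hqp) hxZ
      (by rw [hy, ← pow_one r]; exact hpd hr hrp) hyZ hxy hpg (hZ g hg hpg)
  have hord : ∀ {g : G} {s : ℕ}, s.Prime → s ≠ p → orderOf g = s → g ≠ 1 ∧ ¬ p ∣ orderOf g :=
    fun {g s} hs hsp hg => ⟨ne_one_of_orderOf_eq_prime hs hg, by
      rw [hg, ← pow_one s]; exact hpd hs hsp⟩
  obtain ⟨j, rfl⟩ := Nat.exists_eq_succ_of_ne_zero hk
  have hxq' : orderOf (x ^ q ^ j) = q := by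
    rw [orderOf_pow_of_dvd (pow_ne_zero j hq.ne_zero) (by rw [hx]; exact pow_dvd_pow q j.le_succ),
      hx, pow_succ, Nat.mul_div_cancel_left _ (pow_pos hq.pos j)]
  -- The power of $x$ of order $q$ is itself noncentral, hence conjugate to $x$, since its order
  -- excludes $y$.
  have hxq : orderOf x = q := by
    obtain ⟨h1, h2⟩ := hord hq hqp hxq'
    rcases key _ h1 h2 with h | h
    · rw [← h.orderOf_eq_orderOf, hxq']
    · have := h.orderOf_eq_orderOf
      rw [hxq', hy] at this
      exact absurd this.symm hrq
  have hcx : ∀ g : G, orderOf g = q → IsConj g x := fun g hg =>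
    (key g (hord hq hqp hg).1 (hord hq hqp hg).2).resolve_right fun h => hrq
      (by rw [← hy, ← h.orderOf_eq_orderOf, hg])
  have hcy : ∀ g : G, orderOf g = r → IsConj g y := fun g hg =>
    (key g (hord hr hrp hg).1 (hord hr hrp hg).2).resolve_left fun h => hrq
      (by rw [← hxq, ← h.orderOf_eq_orderOf, hg])
  refine ⟨q, r, hp, hq, hr, hqp, hrp, hrq.symm, fun g hg hpg => ?_, ⟨x, hxq⟩, ⟨y, hy⟩,
    fun g h hg hh => (hcx g hg).trans (hcx h hh).symm,
    fun g h hg hh => (hcy g hg).trans (hcy h hh).symm⟩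
  rcases key g hg hpg with h | h
  · exact .inl (h.orderOf_eq_orderOf.trans hxq)
  · exact .inr (h.orderOf_eq_orderOf.trans hy)

/-! ### Counting elements in centres of Sylow subgroups. -/

/-- If the elements of order `q` lie in centres of Sylow subgroups, and no Sylow `q`-subgroup is
centralized by its normalizer, then less than half of the elements have order `q`. -/
theorem two_mul_ncard_orderOf_eq_add_one_le {M : Type*} [Group M] [Finite M] {q : ℕ}
    [Fact q.Prime]
    (hcen : ∀ x : M, orderOf x = q →
      ∃ P : Sylow q M, x ∈ P ∧ x ∈ Subgroup.centralizer (P : Set M))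
    (hN : ∀ P : Sylow q M,
      ¬ Subgroup.normalizer (P : Set M) ≤ Subgroup.centralizer (P : Set M)) :
    2 * ({x : M | orderOf x = q}.ncard + 1) ≤ Nat.card M := by
  classical
  have := Fintype.ofFinite (Sylow q M)
  let Z : Sylow q M → Subgroup M := fun P => P ⊓ Subgroup.centralizer (P : Set M)
  set n := Nat.card (Sylow q M) with hn
  have hn0 : 0 < n := Nat.card_pos
  -- Here $Z(P)$ is a proper subgroup of $N(P)$, so has index at least 2, and $n\,|N(P)| = |M|$.
  have hZ : ∀ P, n * (2 * Nat.card (Z P)) ≤ Nat.card M := by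
    intro P
    have h1 : n * Nat.card (Subgroup.normalizer (P : Set M)) = Nat.card M := by
      rw [hn, P.card_eq_index_normalizer, Subgroup.index_mul_card]
    rw [← h1]
    refine Nat.mul_le_mul_left n ?_
    have hle : Z P ≤ Subgroup.normalizer (P : Set M) := inf_le_left.trans Subgroup.le_normalizer
    obtain ⟨c, hc⟩ := Subgroup.card_dvd_of_le hle
    have hc0 : c ≠ 0 := by
      rintro rfl
      exact (Nat.card_pos (α := Subgroup.normalizer (P : Set M))).ne' (by simpa using hc)
    have hc1 : c ≠ 1 := by
      rintro rfl
      rw [mul_one] at hc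
      have h2 := Subgroup.eq_of_le_of_card_ge hle hc.le
      exact hN P (h2 ▸ inf_le_right)
    rw [hc, mul_comm]
    exact Nat.mul_le_mul_left _ (by omega)
  have hcover : {x : M | orderOf x = q} ⊆ ⋃ P : Sylow q M, ((Z P : Set M) \ {1}) := by
    intro x hx
    obtain ⟨P, h1, h2⟩ := hcen x hx
    exact Set.mem_iUnion.2 ⟨P, ⟨h1, h2⟩, ne_one_of_orderOf_eq_prime Fact.out hx⟩
  have hle : {x : M | orderOf x = q}.ncard + n ≤ ∑ P, Nat.card (Z P) := by
    have h1 := (Set.ncard_le_ncard hcover (Set.toFinite _)).trans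
      (Set.ncard_iUnion_le_of_fintype _)
    have h2 : ∀ P, ((Z P : Set M) \ {1}).ncard + 1 = Nat.card (Z P) := fun P =>
      Set.ncard_sdiff_singleton_add_one (one_mem (Z P)) (Set.toFinite _)
    have h3 : ∑ P : Sylow q M, (((Z P : Set M) \ {1}).ncard + 1) = ∑ P, Nat.card (Z P) :=
      Finset.sum_congr rfl fun P _ => h2 P
    rw [Finset.sum_add_distrib, Finset.sum_const, Finset.card_univ, ← Nat.card_eq_fintype_card,
      smul_eq_mul, mul_one] at h3
    omega
  have hsum : n * (2 * ∑ P, Nat.card (Z P)) ≤ n * Nat.card M := by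
    rw [Finset.mul_sum, Finset.mul_sum]
    refine (Finset.sum_le_card_nsmul _ _ _ fun P _ => hZ P).trans ?_
    rw [Finset.card_univ, ← Nat.card_eq_fintype_card, smul_eq_mul]
  have := Nat.le_of_mul_le_mul_left hsum hn0
  omega

/-- Otherwise the elements of orders $q$ and $r$ number at most $|M| - 2$ together, but they are all
the nontrivial elements. -/
theorem HasOrdersOneOrTwoPrimes.exists_normalizer_le_centralizer {M : Type*} [Group M] [Finite M]
    {q r : ℕ} [Fact q.Prime] [Fact r.Prime] (h : HasOrdersOneOrTwoPrimes q r M)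
    (hq : ∀ x : M, orderOf x = q →
      ∃ P : Sylow q M, x ∈ P ∧ x ∈ Subgroup.centralizer (P : Set M))
    (hr : ∀ x : M, orderOf x = r →
      ∃ P : Sylow r M, x ∈ P ∧ x ∈ Subgroup.centralizer (P : Set M)) :
    (∃ P : Sylow q M, Subgroup.normalizer (P : Set M) ≤ Subgroup.centralizer (P : Set M)) ∨
    ∃ P : Sylow r M, Subgroup.normalizer (P : Set M) ≤ Subgroup.centralizer (P : Set M) := by
  by_contra! hN
  have h1 := two_mul_ncard_orderOf_eq_add_one_le hq hN.1
  have h2 := two_mul_ncard_orderOf_eq_add_one_le hr hN.2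
  have hcover : (Set.univ : Set M) ⊆ {1} ∪ ({x | orderOf x = q} ∪ {x | orderOf x = r}) := by
    intro x _
    by_cases hx : x = 1
    · exact .inl hx
    · exact .inr (h.orderOf_eq x hx)
  have h3 := Set.ncard_le_ncard hcover (Set.toFinite _)
  rw [Set.ncard_univ] at h3
  have h4 := Set.ncard_union_le ({1} : Set M) ({x | orderOf x = q} ∪ {x | orderOf x = r})
  have h5 := Set.ncard_union_le {x : M | orderOf x = q} {x | orderOf x = r}
  rw [Set.ncard_singleton] at h4
  omega

/-! ### Normal $p'$-subgroups modulo a normal $p$-subgroup. -/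

theorem exists_not_dvd_orderOf_map_eq {G Q : Type*} [Group G] [Finite G] [Group Q] {p : ℕ}
    (hp : p.Prime) {f : G →* Q} (hf : Function.Surjective f) {y : Q} (hy : ¬ p ∣ orderOf y) :
    ∃ x : G, f x = y ∧ ¬ p ∣ orderOf x := by
  obtain ⟨x, rfl⟩ := hf y
  obtain ⟨e, m, hpm, hem⟩ :=
    Nat.exists_eq_pow_mul_and_not_dvd (orderOf_pos x).ne' p hp.ne_one
  have hcop : (p ^ e).Coprime (orderOf (f x)) := ((Nat.Prime.coprime_iff_not_dvd hp).2 hy).pow_left e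
  -- The exponent $k$ kills the $p$-part of $x$ and fixes its image.
  obtain ⟨k, hk0, hk1⟩ := Nat.chineseRemainder hcop 0 1
  refine ⟨x ^ k, ?_, fun h => hpm (h.trans (orderOf_dvd_of_pow_eq_one ?_))⟩
  · rw [map_pow]
    exact (pow_eq_pow_iff_modEq.2 hk1).trans (pow_one _)
  · rw [← pow_mul, ← orderOf_dvd_iff_pow_eq_one, hem]
    exact Nat.mul_dvd_mul_right ((Nat.modEq_zero_iff_dvd).1 hk0) m

namespace HasTwoPrimeOrderClasses

open scoped commutatorElement

variable {p q r : ℕ} {G : Type*} [Group G]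

theorem map [Finite G] (h : HasTwoPrimeOrderClasses p q r G) {Q : Type*} [Group Q] {f : G →* Q}
    (hf : Function.Surjective f) (hker : IsPGroup p f.ker) : HasTwoPrimeOrderClasses p q r Q := by
  have := Fact.mk h.prime
  have hpd : ∀ {s : ℕ}, s.Prime → s ≠ p → ¬ p ∣ s := fun hs hsp h' =>
    hsp ((Nat.prime_dvd_prime_iff_eq h.prime hs).1 h').symm
  have hprime : ∀ {x : G}, x ≠ 1 → ¬ p ∣ orderOf x → (orderOf x).Prime := fun hx hpx =>
    (h.orderOf_eq _ hx hpx).elim (fun e => e ▸ h.prime_left) fun e => e ▸ h.prime_right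
  have hmap : ∀ {s : ℕ} (x : G), s.Prime → s ≠ p → orderOf x = s → orderOf (f x) = s := by
    intro s x hs hsp hx
    refine ((Nat.dvd_prime hs).1 (hx ▸ orderOf_map_dvd f x)).resolve_left fun h1 => ?_
    obtain ⟨k, hk⟩ := IsPGroup.iff_orderOf.1 hker ⟨x, orderOf_eq_one_iff.1 h1⟩
    rw [← Subgroup.orderOf_coe, hx] at hk
    exact hsp ((Nat.prime_dvd_prime_iff_eq hs h.prime).1 (hs.dvd_of_dvd_pow hk.dvd))
  have hlift : ∀ y : Q, y ≠ 1 → ¬ p ∣ orderOf y → ∃ x, f x = y ∧ x ≠ 1 ∧ ¬ p ∣ orderOf x ∧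
      orderOf x = orderOf y := by
    intro y hy hpy
    obtain ⟨x, rfl, hx⟩ := exists_not_dvd_orderOf_map_eq h.prime hf hpy
    have hx1 : x ≠ 1 := by rintro rfl; exact hy (map_one f)
    refine ⟨x, rfl, hx1, hx, ?_⟩
    exact (((Nat.dvd_prime (hprime hx1 hx)).1 (orderOf_map_dvd f x)).resolve_left
      (mt orderOf_eq_one_iff.1 hy)).symm
  have hconj : ∀ {s : ℕ}, s.Prime → s ≠ p → (∀ a b : G, orderOf a = s → orderOf b = s → IsConj a b) →
      ∀ a b : Q, orderOf a = s → orderOf b = s → IsConj a b := by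
    intro s hs hsp hG a b ha hb
    obtain ⟨x, rfl, -, -, hx⟩ := hlift a (ne_one_of_orderOf_eq_prime hs ha) (ha ▸ hpd hs hsp)
    obtain ⟨y, rfl, -, -, hy⟩ := hlift b (ne_one_of_orderOf_eq_prime hs hb) (hb ▸ hpd hs hsp)
    exact f.map_isConj (hG x y (hx.trans ha) (hy.trans hb))
  refine ⟨h.prime, h.prime_left, h.prime_right, h.left_ne, h.right_ne, h.ne, ?_, ?_, ?_, ?_, ?_⟩
  · intro y hy hpy
    obtain ⟨x, -, hx1, hpx, hxy⟩ := hlift y hy hpy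
    rw [← hxy]
    exact h.orderOf_eq x hx1 hpx
  · obtain ⟨x, hx⟩ := h.exists_left
    exact ⟨f x, hmap x h.prime_left h.left_ne hx⟩
  · obtain ⟨x, hx⟩ := h.exists_right
    exact ⟨f x, hmap x h.prime_right h.right_ne hx⟩
  · exact hconj h.prime_left h.left_ne h.isConj_left
  · exact hconj h.prime_right h.right_ne h.isConj_right

theorem mem_of_orderOf_eq (h : HasTwoPrimeOrderClasses p q r G) {M : Subgroup G} [M.Normal]
    {x y : G} (hx : orderOf x = q) (hxM : x ∈ M) (hy : orderOf y = q) : y ∈ M := by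
  obtain ⟨g, rfl⟩ := isConj_iff.1 (h.isConj_left x y hx hy)
  exact Subgroup.Normal.conj_mem ‹_› x hxM g

/-- The centre of $T$ contains an element of order $q$ and is normal in $G$, so it contains all of
them. -/
theorem commute_of_isPGroup [Finite G] (h : HasTwoPrimeOrderClasses p q r G) {T : Subgroup G}
    [T.Normal] (hT : IsPGroup q T) (hne : T ≠ ⊥) {x y : G} (hx : orderOf x = q)
    (hy : orderOf y = q) : Commute x y := by
  have := Fact.mk h.prime_left
  have : Nontrivial T := (Subgroup.nontrivial_iff_ne_bot T).2 hne
  have := hT.center_nontrivial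
  obtain ⟨c, hc1⟩ := exists_ne (1 : Subgroup.center T)
  obtain ⟨k, hk⟩ := IsPGroup.iff_orderOf.1 hT (c : T)
  rw [← Subgroup.orderOf_coe] at hk
  have hc : orderOf ((c : T) : G) = q := by
    refine (h.orderOf_eq _ (by simpa using hc1) fun hd => ?_).resolve_right fun hr => ?_
    · rw [hk] at hd
      exact h.left_ne ((Nat.prime_dvd_prime_iff_eq h.prime h.prime_left).1
        (h.prime.dvd_of_dvd_pow hd)).symm
    · rw [hr] at hk
      exact h.ne ((Nat.prime_dvd_prime_iff_eq h.prime_right h.prime_left).1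
        (h.prime_right.dvd_of_dvd_pow hk.dvd)).symm
  have hyT := h.mem_of_orderOf_eq hc (c : T).2 hy
  obtain ⟨g, rfl⟩ := isConj_iff.1 (h.isConj_left _ _ hc hx)
  have h1 : g⁻¹ * y * g ∈ T := by
    simpa using Subgroup.Normal.conj_mem ‹_› y hyT g⁻¹
  have h2 : g⁻¹ * y * g * (c : T) = (c : T) * (g⁻¹ * y * g) :=
    congrArg Subtype.val (Subgroup.mem_center_iff.1 c.2 ⟨_, h1⟩)
  show g * (c : T) * g⁻¹ * y = y * (g * (c : T) * g⁻¹)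
  calc g * (c : T) * g⁻¹ * y = g * ((c : T) * (g⁻¹ * y * g)) * g⁻¹ := by group
    _ = g * (g⁻¹ * y * g * (c : T)) * g⁻¹ := by rw [h2]
    _ = y * (g * (c : T) * g⁻¹) := by group

/-- Some Sylow centre contains an element of order $q$; conjugation by $G$ carries it to $x$ and
permutes the Sylow subgroups of $M$. -/
theorem exists_sylow_mem_centralizer [Finite G] (h : HasTwoPrimeOrderClasses p q r G)
    [Fact q.Prime] {M : Subgroup G} [M.Normal] (hM : ¬ p ∣ Nat.card M) {x : M}
    (hx : orderOf x = q) :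
    ∃ P : Sylow q M, x ∈ P ∧ x ∈ Subgroup.centralizer (P : Set M) := by
  obtain ⟨P⟩ : Nonempty (Sylow q M) := inferInstance
  have hqM : q ∣ Nat.card M := hx ▸ orderOf_dvd_natCard x
  have : Nontrivial P := by
    rw [← Finite.one_lt_card_iff_nontrivial]
    exact (Nat.Prime.one_lt Fact.out).trans_le
      (Nat.le_of_dvd Nat.card_pos (P.dvd_card_of_dvd_card hqM))
  have := P.isPGroup'.center_nontrivial
  obtain ⟨c, hc1⟩ := exists_ne (1 : Subgroup.center P)
  obtain ⟨k, hk⟩ := IsPGroup.iff_orderOf.1 P.isPGroup' (c : P)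
  rw [← Subgroup.orderOf_coe, ← Subgroup.orderOf_coe] at hk
  have hc : orderOf (((c : P) : M) : G) = q := by
    refine (h.orderOf_eq _ (by simpa using hc1) fun hd => ?_).resolve_right fun hr => ?_
    · rw [Subgroup.orderOf_coe] at hd
      exact hM (hd.trans (orderOf_dvd_natCard _))
    · rw [hr] at hk
      exact h.ne ((Nat.prime_dvd_prime_iff_eq h.prime_right h.prime_left).1
        (h.prime_right.dvd_of_dvd_pow hk.dvd)).symm
  obtain ⟨g, hg⟩ := isConj_iff.1 (h.isConj_left _ _ hc ((Subgroup.orderOf_coe x).trans hx))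
  have hgx : (MulAut.conjNormal g : MulAut M) • ((c : P) : M) = x := Subtype.ext hg
  refine ⟨(MulAut.conjNormal g : MulAut M) • P, ?_, ?_⟩
  · rw [← hgx]
    exact Subgroup.smul_mem_pointwise_smul _ _ _ (c : P).2
  · rw [Subgroup.mem_centralizer_iff]
    intro y hy
    obtain ⟨y, hyP, rfl⟩ := Subgroup.mem_smul_pointwise_iff_exists _ _ _ |>.1 hy
    rw [← hgx, ← smul_mul', ← smul_mul']
    have h2 : y * (c : P) = (c : P) * y :=
      congrArg Subtype.val (Subgroup.mem_center_iff.1 c.2 ⟨y, hyP⟩)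
    rw [h2]

/-- Burnside's transfer theorem gives a normal $q$-complement in $M$. It consists of $1$ and the
elements of order $r$, so it is an $r$-group normal in $G$. -/
theorem commute_right_of_normalizer_le [Finite G] (h : HasTwoPrimeOrderClasses p q r G)
    [Fact q.Prime] {M : Subgroup G} [M.Normal] (hM : ¬ p ∣ Nat.card M) {y₀ : G}
    (hy₀M : y₀ ∈ M) (hy₀ : orderOf y₀ = r) (P : Sylow q M)
    (hP : Subgroup.normalizer (P : Set M) ≤ Subgroup.centralizer (P : Set M)) {x y : G}
    (hx : orderOf x = r) (hy : orderOf y = r) : Commute x y := by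
  set T := (MonoidHom.transferSylow P hP).ker
  have hcompl : T.IsComplement' (P : Subgroup M) := MonoidHom.ker_transferSylow_isComplement' P hP
  have hqT : ¬ q ∣ Nat.card T := by
    have h1 : (P : Subgroup M).index = Nat.card T := hcompl.index_eq_card
    rw [← h1]
    exact P.not_dvd_index
  have hmem : ∀ g : G, g ∈ T.map M.subtype ↔ g = 1 ∨ orderOf g = r := by
    intro g
    constructor
    · rintro ⟨t, ht, rfl⟩
      by_cases ht1 : t = 1
      · exact .inl (by simp [ht1])
      refine .inr ((h.orderOf_eq _ (by simpa using ht1) fun hd => ?_).resolve_left fun hq => ?_)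
      · rw [Subgroup.coe_subtype, Subgroup.orderOf_coe] at hd
        exact hM (hd.trans (orderOf_dvd_natCard _))
      · rw [Subgroup.coe_subtype, Subgroup.orderOf_coe, ← Subgroup.orderOf_mk t ht] at hq
        exact hqT (hq ▸ orderOf_dvd_natCard _)
    · rintro (rfl | hg)
      · exact one_mem _
      have hgM : g ∈ M := h.symm.mem_of_orderOf_eq hy₀ hy₀M hg
      refine ⟨⟨g, hgM⟩, ?_, rfl⟩
      show MonoidHom.transferSylow P hP ⟨g, hgM⟩ = 1
      rw [← orderOf_eq_one_iff]
      have h1 := orderOf_map_dvd (MonoidHom.transferSylow P hP) ⟨g, hgM⟩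
      rw [(Subgroup.orderOf_mk g hgM).trans hg] at h1
      refine ((Nat.dvd_prime h.prime_right).1 h1).resolve_right fun h2 => ?_
      obtain ⟨k, hk⟩ := IsPGroup.iff_orderOf.1 P.isPGroup' (MonoidHom.transferSylow P hP ⟨g, hgM⟩)
      rw [h2] at hk
      exact h.ne ((Nat.prime_dvd_prime_iff_eq h.prime_right h.prime_left).1
        (h.prime_right.dvd_of_dvd_pow hk.dvd)).symm
  have hnorm : (T.map M.subtype).Normal := by
    constructor
    intro n hn g
    rw [hmem] at hn ⊢
    rcases hn with rfl | hn
    · exact .inl (by rw [mul_one, mul_inv_cancel])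
    · exact .inr ((isConj_iff.2 ⟨g, rfl⟩ : IsConj n _).orderOf_eq_orderOf ▸ hn)
  refine h.symm.commute_of_isPGroup (T := T.map M.subtype) ?_ ?_ hx hy
  · refine isPGroup_of_forall_orderOf_eq fun t ht => ?_
    rw [← Subgroup.orderOf_coe]
    exact ((hmem t).1 t.2).resolve_left (by simpa using ht)
  · intro hbot
    have := (hmem y₀).2 (.inr hy₀)
    rw [hbot, Subgroup.mem_bot] at this
    exact ne_one_of_orderOf_eq_prime h.prime_right hy₀ this

theorem commute_or_commute_of_normal [Finite G] (h : HasTwoPrimeOrderClasses p q r G)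
    {M : Subgroup G} [M.Normal] (hM : ¬ p ∣ Nat.card M) (hne : M ≠ ⊥) :
    (∀ x y : G, orderOf x = q → orderOf y = q → Commute x y) ∨
    ∀ x y : G, orderOf x = r → orderOf y = r → Commute x y := by
  have := Fact.mk h.prime_left
  have := Fact.mk h.prime_right
  have hord : ∀ m : M, m ≠ 1 → orderOf m = q ∨ orderOf m = r := fun m hm => by
    have := h.orderOf_eq (m : G) (by simpa using hm) (by
      rw [Subgroup.orderOf_coe]; exact fun hd => hM (hd.trans (orderOf_dvd_natCard m)))
    rwa [Subgroup.orderOf_coe] at this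
  by_cases hq : ∃ m : M, orderOf m = q
  · by_cases hr : ∃ m : M, orderOf m = r
    · have hMo : HasOrdersOneOrTwoPrimes q r M :=
        ⟨h.prime_left, h.prime_right, h.ne, hord, hq, hr⟩
      obtain ⟨a, ha⟩ := hq
      obtain ⟨b, hb⟩ := hr
      rcases hMo.exists_normalizer_le_centralizer
        (fun x hx => h.exists_sylow_mem_centralizer hM hx)
        (fun x hx => h.symm.exists_sylow_mem_centralizer hM hx) with ⟨P, hP⟩ | ⟨P, hP⟩
      · exact .inr fun x y hx hy => h.commute_right_of_normalizer_le hM b.2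
          ((Subgroup.orderOf_coe b).trans hb) P hP hx hy
      · exact .inl fun x y hx hy => h.symm.commute_right_of_normalizer_le hM a.2
          ((Subgroup.orderOf_coe a).trans ha) P hP hx hy
    · refine .inl fun x y hx hy => h.commute_of_isPGroup (T := M) ?_ hne hx hy
      exact isPGroup_of_forall_orderOf_eq fun m hm =>
        (hord m hm).resolve_right fun hm' => hr ⟨m, hm'⟩
  · refine .inr fun x y hx hy => h.symm.commute_of_isPGroup (T := M) ?_ hne hx hy
    exact isPGroup_of_forall_orderOf_eq fun m hm =>
      (hord m hm).resolve_left fun hm' => hq ⟨m, hm'⟩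

/-- In a `p`-separable group, the elements of order `q` or those of order `r` commute modulo a
normal `p`-subgroup. -/
theorem exists_normal_commutator_mem [Finite G] (h : HasTwoPrimeOrderClasses p q r G)
    (hG : IsPSeparable p G) : ∃ O : Subgroup G, IsPGroup p O ∧
      ((∀ x y : G, orderOf x = q → orderOf y = q → ⁅x, y⁆ ∈ O) ∨
      ∀ x y : G, orderOf x = r → orderOf y = r → ⁅x, y⁆ ∈ O) := by
  classical
  have := Fact.mk h.prime
  obtain ⟨n, N, h0, hn, hN, hstep⟩ := hG
  -- Take the first term of the series that is not a $p$-group: its predecessor is the required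
  -- $p$-subgroup, and the factor between them is a nontrivial $p'$-group.
  have hex : ∃ i, ¬ IsPGroup p (N i) := by
    refine ⟨n, fun hp => ?_⟩
    obtain ⟨x, hx⟩ := h.exists_left
    obtain ⟨k, hk⟩ := IsPGroup.iff_orderOf.1 hp ⟨x, hn ▸ Subgroup.mem_top x⟩
    rw [Subgroup.orderOf_mk, hx] at hk
    exact h.left_ne ((Nat.prime_dvd_prime_iff_eq h.prime_left h.prime).1
      (h.prime_left.dvd_of_dvd_pow hk.dvd))
  have hfind := Nat.find_spec hex
  obtain ⟨i, hi⟩ : ∃ i, Nat.find hex = i + 1 := by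
    refine Nat.exists_eq_succ_of_ne_zero fun hz => hfind ?_
    rw [hz, h0]
    exact IsPGroup.of_bot
  have hpi : IsPGroup p (N i) := not_not.1 (Nat.find_min hex (by omega))
  rw [hi] at hfind
  have hin : i < n := by
    by_contra hni
    have hle : n < Nat.find hex := by omega
    have := not_not.1 (Nat.find_min hex hle)
    rw [hn] at this
    exact hfind (this.to_le le_top)
  obtain ⟨hle, hfac⟩ := hstep i hin
  have hcard : Nat.card (N i) * (N i).relIndex (N (i + 1)) = Nat.card (N (i + 1)) := by
    have := Subgroup.relIndex_mul_relIndex ⊥ (N i) (N (i + 1)) bot_le hle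
    rwa [Subgroup.relIndex_bot_left, Subgroup.relIndex_bot_left] at this
  have hnd : ¬ p ∣ (N i).relIndex (N (i + 1)) := by
    refine hfac.resolve_left ?_
    rintro ⟨k, hk⟩
    obtain ⟨l, hl⟩ := IsPGroup.iff_card.1 hpi
    exact hfind (IsPGroup.of_card (n := l + k) (by rw [← hcard, hk, hl, pow_add]))
  have hNi := hN i
  have hNi1 := hN (i + 1)
  let f := QuotientGroup.mk' (N i)
  have hfs : Function.Surjective f := QuotientGroup.mk'_surjective _
  have hker : f.ker = N i := QuotientGroup.ker_mk' _
  have h' : HasTwoPrimeOrderClasses p q r (G ⧸ N i) := h.map hfs (by rw [hker]; exact hpi)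
  have hMn : ((N (i + 1)).map f).Normal := hNi1.map f hfs
  have hMc : ¬ p ∣ Nat.card ((N (i + 1)).map f) := by
    rw [← Subgroup.relIndex_ker, hker]; exact hnd
  have hMb : (N (i + 1)).map f ≠ ⊥ := by
    rw [Ne, Subgroup.map_eq_bot_iff, hker]
    exact fun hle => hfind (hpi.to_le hle)
  have hord : ∀ {s : ℕ} {x : G}, s.Prime → s ≠ p → orderOf x = s → orderOf (f x) = s := by
    intro s x hs hsp hx
    refine ((Nat.dvd_prime hs).1 (hx ▸ orderOf_map_dvd f x)).resolve_left fun h1 => ?_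
    obtain ⟨k, hk⟩ := IsPGroup.iff_orderOf.1 hpi
      ⟨x, hker ▸ (MonoidHom.mem_ker.2 (orderOf_eq_one_iff.1 h1) : x ∈ f.ker)⟩
    rw [Subgroup.orderOf_mk, hx] at hk
    exact hsp ((Nat.prime_dvd_prime_iff_eq hs h.prime).1 (hs.dvd_of_dvd_pow hk.dvd))
  have hcomm : ∀ x y : G, Commute (f x) (f y) → ⁅x, y⁆ ∈ N i := by
    intro x y hxy
    rw [← hker, MonoidHom.mem_ker, map_commutatorElement]
    exact commutatorElement_eq_one_iff_commute.2 hxy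
  refine ⟨N i, hpi, (h'.commute_or_commute_of_normal hMc hMb).imp ?_ ?_⟩
  · exact fun H x y hx hy => hcomm x y (H _ _ (hord h.prime_left h.left_ne hx)
      (hord h.prime_left h.left_ne hy))
  · exact fun H x y hx hy => hcomm x y (H _ _ (hord h.prime_right h.right_ne hx)
      (hord h.prime_right h.right_ne hy))

/-! ### Passage to the $p$-complement. -/

theorem hasOrdersOneOrTwoPrimes [Finite G] (h : HasTwoPrimeOrderClasses p q r G) {H : Subgroup G}
    (hH : IsPComplement p H) : HasOrdersOneOrTwoPrimes q r H := by
  have hex : ∀ {s : ℕ}, s.Prime → s ≠ p → (∃ x : G, orderOf x = s) → ∃ x : H, orderOf x = s := by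
    rintro s hs hsp ⟨x, hx⟩
    have := Fact.mk hs
    refine exists_prime_orderOf_dvd_card' s ?_
    have h1 : s ∣ Nat.card G := hx ▸ orderOf_dvd_natCard x
    obtain ⟨k, hk⟩ := hH.2
    rw [← H.card_mul_index, hk] at h1
    refine (hs.dvd_mul.1 h1).resolve_right fun h2 => hsp ?_
    exact (Nat.prime_dvd_prime_iff_eq hs h.prime).1 (hs.dvd_of_dvd_pow h2)
  refine ⟨h.prime_left, h.prime_right, h.ne, fun x hx => ?_, hex h.prime_left h.left_ne h.exists_left,
    hex h.prime_right h.right_ne h.exists_right⟩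
  rw [← Subgroup.orderOf_coe]
  refine h.orderOf_eq _ (by simpa using hx) fun hd => hH.1 (hd.trans ?_)
  rw [Subgroup.orderOf_coe]
  exact orderOf_dvd_natCard x

/-- If the elements of order `q` commute modulo a `p`-subgroup, then the `p`-complements are
Frobenius groups with elementary abelian `q`-kernel and complements of order `r`. -/
theorem frobenius_of_commutator_mem [Finite G] (h : HasTwoPrimeOrderClasses p q r G)
    {H : Subgroup G} (hH : IsPComplement p H) {O : Subgroup G} (hO : IsPGroup p O)
    (hc : ∀ x y : G, orderOf x = q → orderOf y = q → ⁅x, y⁆ ∈ O) :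
    IsFrobeniusGroup H ∧ ∀ K C : Subgroup H, IsFrobeniusWith K C →
      IsElementaryAbelian q K ∧ Nat.card C = r := by
  have := Fact.mk h.prime
  have := Fact.mk h.prime_left
  have hHo := h.hasOrdersOneOrTwoPrimes hH
  have hc' : ∀ x y : H, x ^ q = 1 → y ^ q = 1 → Commute x y := by
    intro x y hx hy
    by_cases hx1 : x = 1
    · rw [hx1]; exact Commute.one_left y
    by_cases hy1 : y = 1
    · rw [hy1]; exact Commute.one_right x
    have h1 := hc x y (by rw [Subgroup.orderOf_coe, orderOf_eq_prime hx hx1])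
      (by rw [Subgroup.orderOf_coe, orderOf_eq_prime hy hy1])
    -- The commutator has $p$-power order and lies in the $p'$-group $H$, so it is trivial.
    obtain ⟨k, hk⟩ := IsPGroup.iff_orderOf.1 hO ⟨_, h1⟩
    rw [Subgroup.orderOf_mk] at hk
    rw [← commutatorElement_eq_one_iff_commute, ← orderOf_eq_one_iff]
    have h2 : orderOf ⁅x, y⁆ = p ^ k := by rw [← hk, ← Subgroup.orderOf_coe]; rfl
    have h3 : orderOf ⁅x, y⁆ ∣ Nat.card H := orderOf_dvd_natCard _
    rw [h2] at h3 ⊢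
    rcases Nat.eq_zero_or_pos k with rfl | hk0
    · exact pow_zero p
    · exact absurd ((dvd_pow_self p hk0.ne').trans h3) hH.1
  exact ⟨hHo.isFrobeniusGroup hc', fun K C => hHo.of_isFrobeniusWith hc'⟩

end HasTwoPrimeOrderClasses

theorem mainTheorem10 {G : Type*} [Group G] [Finite G] (p : ℕ) (hp : p.Prime)
    (hG : IsPSeparable p G) (H : Subgroup G) (hH : IsPComplement p H)
    (hV : Nat.card (PRegularNoncentralClass p G) = 2)
    (hE : (commonDivisorGraph p G).edgeSet.ncard = 1) :
    (∃ q : ℕ, q.Prime ∧ q ≠ p ∧ IsPGroup q H) ∨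
    (∃ q r : ℕ, q.Prime ∧ r.Prime ∧ q ≠ r ∧ q ≠ p ∧ r ≠ p ∧ IsFrobeniusGroup H ∧
      ∀ K C : Subgroup H, IsFrobeniusWith K C →
        IsElementaryAbelian q K ∧ Nat.card C = r) := by
  refine or_iff_not_imp_left.2 fun hnot => ?_
  -- If $p$ and $q$ were the only possible prime divisors of $|G|$, then $H$ would be a $q$-group.
  have hN : ∀ q : ℕ, q.Prime → q ≠ p → ∃ s : ℕ, s.Prime ∧ s ≠ p ∧ s ≠ q ∧ s ∣ Nat.card G := by
    intro q hq hqp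
    by_contra! hall
    refine hnot ⟨q, hq, hqp, IsPGroup.of_card
      (Nat.eq_prime_pow_of_unique_prime_dvd Nat.card_pos.ne' fun {s} hs hsH => ?_)⟩
    by_contra hsq
    exact hall s hs (fun hsp => hH.1 (hsp ▸ hsH)) hsq
      (hsH.trans (Subgroup.card_subgroup_dvd_card H))
  obtain ⟨q, r, h⟩ := exists_hasTwoPrimeOrderClasses hp hV hN
  obtain ⟨O, hO, hc | hc⟩ := h.exists_normal_commutator_mem hG
  · exact ⟨q, r, h.prime_left, h.prime_right, h.ne, h.left_ne, h.right_ne,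
      h.frobenius_of_commutator_mem hH hO hc⟩
  · exact ⟨r, q, h.prime_right, h.prime_left, h.ne.symm, h.right_ne, h.left_ne,
      h.symm.frobenius_of_commutator_mem hH hO hc⟩
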